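/- Let $m\ge 1$, and let quadratures satisfy $[\hat q_j,\hat p_k]=i\delta_{jk}$ (vacuum covariance matrix $\tfrac12 I$). Let $\Phi$ be a fully symmetric $m$-mode CV-GHZ state: the Gaussian state with zero first moments whose covariance matrix has every diagonal $2\times2$ block equal to $\mu I$ and every off-diagonal $2\times2$ block equal to $\mathrm{diag}(c_1,c_2)$, where $\mu,c_1,c_2$ are any real parameters for which this is the covariance matrix of a quantum state (for $m\ge2$, maximal correlations are $c_1=-c_2=\sqrt{\mu^2-1/4}/(m-1)$). Let $\mathcal E_B=\mathcal E_{\tau_B,\nu_B}$ (background) and $\mathcal E_T=\mathcal E_{\tau_T,\nu_T}$ (target) be single-mode Gaussian phase-insensitive channels, with $\tau\ge0$ and $\nu\ge|1-\tau|/2$, where $\mathcal E_{\tau,\nu}$ acts on first moments by $r\mapsto\sqrt\tau\,r$ and on covariance matrices by $V\mapsto\tau V+\nu I$. For a binary pattern $\boldsymbol i\in\{B,T\}^m$ let $\Phi_{\boldsymbol i}=\big(\bigotimes_{k=1}^m\mathcal E_{i_k}\big)(\Phi)$, and let $F(\rho,\sigma)=\mathrm{Tr}\sqrt{\sqrt\rho\,\sigma\sqrt\rho}$.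 Let $\mathcal U,\mathcal V\subseteq\{B,T\}^m$ be two image spaces such that every pattern in $\mathcal U$ has the same number $u$ of targets, every pattern in $\mathcal V$ has the same number $v$ of targets, and for some $d>0$ any two unequal patterns $\boldsymbol i\in\mathcal U$, $\boldsymbol i'\in\mathcal V$ have Hamming distance $d$. Then the output fidelity $F(\Phi_{\boldsymbol i},\Phi_{\boldsymbol i'})$ takes the same value for all $\boldsymbol i\in\mathcal U$, $\boldsymbol i'\in\mathcal V$ with $\boldsymbol i\ne\boldsymbol i'$. Moreover, for given $\Phi,\mathcal E_B,\mathcal E_T$, this common value $\tilde F_{uv}(d)$ depends on $\mathcal U,\mathcal V$ only through $u$, $v$ and $d$. -/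

import Mathlib

open MeasureTheory Matrix
open scoped InnerProductSpace ENNReal

noncomputable section

namespace BosonicPattern

/-! ### Trace, states and fidelity; the Hilbert space of `m` bosonic modes -/

section Hilbert

variable {H : Type*} [NormedAddCommGroup H] [InnerProductSpace ℂ H] [CompleteSpace H]

variable (H) in
/-- The index set of a fixed orthonormal basis of `H`. -/
def onbIndex : Set H := (exists_hilbertBasis ℂ H).choose

variable (H) in
/-- A fixed orthonormal (Hilbert) basis of `H`. -/
def onb : HilbertBasis (onbIndex H) ℂ H := (exists_hilbertBasis ℂ H).choose_spec.choose

/-- The trace `Tr A = ∑ₙ ⟨eₙ, A eₙ⟩`. It is only applied to trace-class operators, for which the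
sum converges absolutely and does not depend on the orthonormal basis. -/
def opTrace (A : H →L[ℂ] H) : ℂ := ∑' n, ⟪onb H n, A (onb H n)⟫_ℂ

/-- `ρ` is a quantum state: a density operator, that is, a positive operator of trace one. (For a
positive operator, convergence of the diagonal sum means trace class.) -/
structure IsState (ρ : H →L[ℂ] H) : Prop where
  positive : ρ.IsPositive
  trace_one : HasSum (fun n => ⟪onb H n, ρ (onb H n)⟫_ℂ) 1

/-- The (Bures, non-squared) fidelity `F(ρ, σ) = Tr √(√ρ σ √ρ)`. -/
def fidelity (ρ σ : H →L[ℂ] H) : ℝ :=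
  (opTrace (CFC.sqrt (CFC.sqrt ρ * σ * CFC.sqrt ρ))).re

end Hilbert

/-- The Hilbert space `L²(ℝᵐ; ℂ)` of `m` bosonic modes (position representation). -/
abbrev ModeSpace (m : ℕ) : Type := Lp ℂ 2 (volume : Measure (Fin m → ℝ))

/-- Bounded operators on the space of `m` modes. -/
abbrev Op (m : ℕ) : Type := ModeSpace m →L[ℂ] ModeSpace m

/-! ### Phase space: Weyl operators and characteristic functions

Quadratures are ordered mode by mode: `(k, 0)` is the position `q_k` and `(k, 1)` the momentum
`p_k`, with `[q_j, p_k] = i δ_{jk}`, so that the vacuum covariance matrix is `I / 2`. -/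

/-- The index set of the quadratures of `m` modes. -/
abbrev Quad (m : ℕ) : Type := Fin m × Fin 2

/-- The translation `f ↦ f (· + b)`, i.e. `exp (i ∑ₖ bₖ pₖ)`. -/
def translation {m : ℕ} (b : Fin m → ℝ) : Op m :=
  (Lp.compMeasurePreservingₗᵢ ℂ (fun x : Fin m → ℝ => x + b)
    (measurePreserving_add_right volume b)).toContinuousLinearMap

/-- The phase `exp (i ∑ₖ aₖ xₖ)`. -/
def phase {m : ℕ} (a x : Fin m → ℝ) : ℂ := Complex.exp (((a ⬝ᵥ x : ℝ) : ℂ) * Complex.I)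

lemma norm_phase {m : ℕ} (a x : Fin m → ℝ) : ‖phase a x‖ = 1 :=
  Complex.norm_exp_ofReal_mul_I _

lemma continuous_phase {m : ℕ} (a : Fin m → ℝ) : Continuous (phase a) := by
  unfold phase dotProduct
  fun_prop

lemma memLp_phase_mul {m : ℕ} (a : Fin m → ℝ) (f : ModeSpace m) :
    MemLp (fun x => phase a x * f x) 2 volume :=
  (Lp.memLp f).of_le ((continuous_phase a).aestronglyMeasurable.mul (Lp.aestronglyMeasurable f))
    (Filter.Eventually.of_forall fun x => by rw [norm_mul, norm_phase, one_mul])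

/-- Multiplication by `exp (i ∑ₖ aₖ xₖ)` as a linear map. -/
def modulationLin {m : ℕ} (a : Fin m → ℝ) : ModeSpace m →ₗ[ℂ] ModeSpace m where
  toFun f := (memLp_phase_mul a f).toLp _
  map_add' f g := by
    rw [← MemLp.toLp_add]
    refine MemLp.toLp_congr _ _ ?_
    filter_upwards [Lp.coeFn_add f g] with x hx
    rw [hx, Pi.add_apply, mul_add]
    rfl
  map_smul' c f := by
    rw [RingHom.id_apply, ← MemLp.toLp_const_smul]
    refine MemLp.toLp_congr _ _ ?_
    filter_upwards [Lp.coeFn_smul c f] with x hx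
    simp [hx, mul_left_comm]

lemma modulationLin_coeFn {m : ℕ} (a : Fin m → ℝ) (f : ModeSpace m) :
    modulationLin a f =ᵐ[volume] fun x => phase a x * f x :=
  (memLp_phase_mul a f).coeFn_toLp

/-- The bounded operator `(M f)(x) = exp (i ∑ₖ aₖ xₖ) f(x)`, i.e. `exp (i ∑ₖ aₖ qₖ)`. -/
def modulation {m : ℕ} (a : Fin m → ℝ) : Op m :=
  (modulationLin a).mkContinuous 1 fun f => by
    rw [one_mul]
    refine Lp.norm_le_norm_of_ae_le ?_
    filter_upwards [modulationLin_coeFn a f] with x hx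
    rw [hx, norm_mul, norm_phase, one_mul]

/-- The Weyl operator `W(ξ) = exp (i ξ · r̂) = exp (i ∑ₖ (aₖ qₖ + bₖ pₖ))` with `a = ξ (·, 0)`,
`b = ξ (·, 1)`; explicitly `(W(ξ) f)(x) = exp (i a·b / 2) exp (i a·x) f(x + b)`. -/
def weyl {m : ℕ} (ξ : Quad m → ℝ) : Op m :=
  Complex.exp ((((∑ k, ξ (k, 0) * ξ (k, 1)) / 2 : ℝ) : ℂ) * Complex.I) •
    (modulation (fun k => ξ (k, 0)) * translation (fun k => ξ (k, 1)))

/-- The characteristic function `χ_ρ(ξ) = Tr (ρ W(ξ))`; it determines the state `ρ`. -/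
def charFn {m : ℕ} (ρ : Op m) (ξ : Quad m → ℝ) : ℂ := opTrace (ρ * weyl ξ)

/-- `exp (- ξᵀ V ξ / 2)`. -/
def gaussianFactor {m : ℕ} (V : Matrix (Quad m) (Quad m) ℝ) (ξ : Quad m → ℝ) : ℂ :=
  ((Real.exp (-(ξ ⬝ᵥ V *ᵥ ξ) / 2) : ℝ) : ℂ)

/-- `ρ` is the Gaussian state with zero first moments and covariance matrix `V`. -/
structure IsGaussianState {m : ℕ} (V : Matrix (Quad m) (Quad m) ℝ) (ρ : Op m) : Prop where
  isState : IsState ρ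
  charFn_eq : ∀ ξ, charFn ρ ξ = gaussianFactor V ξ

/-! ### The fully symmetric CV-GHZ state -/

/-- The covariance matrix with `2 × 2` blocks `μ I` on the diagonal and `diag (c₁, c₂)` off the
diagonal. -/
def ghzCov (m : ℕ) (μ c₁ c₂ : ℝ) : Matrix (Quad m) (Quad m) ℝ :=
  Matrix.of fun r s =>
    if r.2 = s.2 then (if r.1 = s.1 then μ else if r.2 = 0 then c₁ else c₂) else 0

/-- `Φ` is the fully symmetric `m`-mode CV-GHZ state with parameters `μ, c₁, c₂`. Maximal
correlations are the case `c₁ = -c₂ = √(μ² - 1/4) / (m - 1)`. That `Φ` is a state forces the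
parameters to be physical. -/
def IsGHZState (m : ℕ) (μ c₁ c₂ : ℝ) (Φ : Op m) : Prop := IsGaussianState (ghzCov m μ c₁ c₂) Φ

/-! ### Gaussian phase-insensitive channels and channel patterns -/

/-- The parameters of a single-mode Gaussian phase-insensitive channel `ℰ_{τ,ν}`: transmissivity
`τ` and induced noise `ν`, subject to complete positivity. Pure loss is `0 ≤ τ ≤ 1`,
`ν = (1 - τ)/2`; thermal loss and amplification are `ν = ε |1 - τ|` with `ε ≥ 1/2`; additive
noise is `τ = 1`, `ν ≥ 0`. -/
structure GPIChannel where
  τ : ℝ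
  ν : ℝ
  τ_nonneg : 0 ≤ τ
  noise_le : |1 - τ| / 2 ≤ ν

/-- A binary pattern of length `m`: `true` marks a target channel, `false` a background channel. -/
abbrev Pattern (m : ℕ) : Type := Fin m → Bool

/-- The number of target channels of a pattern. -/
def numTargets {m : ℕ} (i : Pattern m) : ℕ := (Finset.univ.filter fun k => i k = true).card

/-- The `k`-th channel of the pattern `i`, for given background and target channels. -/
def channelAt {m : ℕ} (B T : GPIChannel) (i : Pattern m) (k : Fin m) : GPIChannel :=
  if i k = true then T else B

/-- The matrix `⨁ₖ xₖ I` (with `2 × 2` identity blocks). -/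
def blockScalar {m : ℕ} (x : Fin m → ℝ) : Matrix (Quad m) (Quad m) ℝ :=
  Matrix.diagonal fun r => x r.1

/-- `σ` is the image of the state `ρ` under the multi-mode Gaussian channel that acts by
`V ↦ X V Xᵀ + Y` on covariance matrices (and by `r ↦ X r` on first moments):
`χ_σ(ξ) = χ_ρ(Xᵀ ξ) exp (- ξᵀ Y ξ / 2)`. -/
structure IsGaussianImage {m : ℕ} (X Y : Matrix (Quad m) (Quad m) ℝ) (ρ σ : Op m) : Prop where
  isState : IsState σ
  charFn_eq : ∀ ξ, charFn σ ξ = charFn ρ (Xᵀ *ᵥ ξ) * gaussianFactor Y ξ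

open Classical in
/-- The output `ℰ_i(ρ)` of the channel pattern `ℰ_i = ⨂ₖ ℰ_{i_k}` on an input state `ρ`, i.e. of
the Gaussian channel with `X = ⨁ₖ √τ_{i_k} I` and `Y = ⨁ₖ ν_{i_k} I`. For every input state there
is exactly one such output state, since `(τ_{i_k}, ν_{i_k})` are parameters of a channel. (The
value `0` is the default for operators `ρ` that are not states.) -/
def patternOutput {m : ℕ} (B T : GPIChannel) (i : Pattern m) (ρ : Op m) : Op m :=
  if h : ∃ σ, IsGaussianImage (blockScalar fun k => √(channelAt B T i k).τ)
      (blockScalar fun k => (channelAt B T i k).ν) ρ σ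
  then h.choose else 0

end BosonicPattern

end

/-!
Two pairs of patterns `(i, i')` and `(j, j')` with the same numbers of targets and the same Hamming
distance have, for each of the four possible pairs of labels, the same number of modes carrying it.
Hence some permutation `e` of the modes turns one pair into the other
(`exists_perm_of_numTargets_eq`). Permuting modes is implemented by a unitary `U` on `L²(ℝᵐ)`, under
which Weyl operators are relabelled (`weyl_relabel`). The input state is fixed by `U`, because its
covariance matrix is fully symmetric, and so conjugation by `U` carries the output of one channel
pattern to the output of the permuted one (`patternOutput_relabel`). Fidelity is unitarily
invariant (`fidelity_conj`).

Since states are given here through their characteristic functions, two analytic facts have to be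
supplied.

* The trace is independent of the orthonormal basis. For positive `A` the diagonal sum is the
  squared Hilbert–Schmidt norm of `√A`; for `ρ A` with `ρ` a state it is the Hilbert–Schmidt inner
  product of `√ρ` with `A √ρ` (`IsState.opTrace_mul`).
* The characteristic function determines the state (`IsState.eq_of_charFn_eq`). Write
  `ρ = ∑ₙ |ψₙ⟩⟨ψₙ|`. For a fixed displacement `b`, the function `a ↦ Tr (ρ W(a, b))` is, up to a
  phase, the Fourier transform in `x` of the integrable function
  `∑ₙ conj (ψₙ(x)) ψₙ(x + b)`, so it determines this function for almost every `x`. That is the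
  complex conjugate of the integral kernel of `ρ` at `(x, x + b)`, and all matrix elements of `ρ`
  are integrals against it.
-/

noncomputable section

namespace BosonicPattern

/-! ### Basis independence of the trace -/

section Trace

open ContinuousLinearMap

variable {H : Type*} [NormedAddCommGroup H] [InnerProductSpace ℂ H]
variable {ι κ : Type*}

lemma hasSum_sq_norm_inner (b : HilbertBasis ι ℂ H) (x : H) :
    HasSum (fun n => ‖⟪b n, x⟫_ℂ‖ ^ 2) (‖x‖ ^ 2) := by
  have h := Complex.hasSum_re (b.hasSum_inner_mul_inner x x)
  rw [inner_self_eq_norm_sq_to_K] at h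
  convert h using 1
  · ext n
    rw [← inner_conj_symm x (b n), mul_comm, Complex.mul_conj, Complex.normSq_eq_norm_sq]
    norm_cast
  · norm_cast

lemma tsum_sq_enorm_inner (b : HilbertBasis ι ℂ H) (x : H) :
    ∑' n, ‖⟪b n, x⟫_ℂ‖ₑ ^ 2 = ‖x‖ₑ ^ 2 := by
  have h : HasSum (fun n => ‖⟪b n, x⟫_ℂ‖₊ ^ 2) (‖x‖₊ ^ 2) := by
    rw [← NNReal.hasSum_coe]
    simpa using hasSum_sq_norm_inner b x
  simpa [enorm] using (ENNReal.hasSum_coe.2 h).tsum_eq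

/-- The image of an orthonormal basis under a unitary. -/
def mapBasis {ι : Type*} (b : HilbertBasis ι ℂ H) (e : H ≃ₗᵢ[ℂ] H) : HilbertBasis ι ℂ H :=
  .ofRepr (e.symm.trans b.repr)

lemma mapBasis_apply {ι : Type*} (b : HilbertBasis ι ℂ H) (e : H ≃ₗᵢ[ℂ] H) (n : ι) :
    mapBasis b e n = e (b n) := by
  classical
  rw [← HilbertBasis.repr_symm_single, ← HilbertBasis.repr_symm_single]
  rfl

variable [CompleteSpace H]

/-- The Hilbert–Schmidt norm of an operator equals that of its adjoint, whatever orthonormal bases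
are used to compute them. -/
lemma tsum_sq_enorm_apply (b : HilbertBasis ι ℂ H) (c : HilbertBasis κ ℂ H) (S : H →L[ℂ] H) :
    ∑' n, ‖S (b n)‖ₑ ^ 2 = ∑' k, ‖adjoint S (c k)‖ₑ ^ 2 := by
  simp_rw [← tsum_sq_enorm_inner c (S _), ← tsum_sq_enorm_inner b (adjoint S _)]
  rw [ENNReal.tsum_comm]
  refine tsum_congr fun k => tsum_congr fun n => ?_
  rw [adjoint_inner_right, ← ofReal_norm, ← ofReal_norm, norm_inner_symm]

lemma sqrt_mul_sqrt {A : H →L[ℂ] H} (hA : A.IsPositive) : CFC.sqrt A * CFC.sqrt A = A :=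
  CFC.sqrt_mul_sqrt_self A ((nonneg_iff_isPositive A).2 hA)

lemma sqrt_apply_sqrt_apply {A : H →L[ℂ] H} (hA : A.IsPositive) (x : H) :
    CFC.sqrt A (CFC.sqrt A x) = A x :=
  DFunLike.congr_fun (sqrt_mul_sqrt hA) x

lemma adjoint_sqrt (A : H →L[ℂ] H) : adjoint (CFC.sqrt A) = CFC.sqrt A :=
  (CFC.sqrt_nonneg A).isSelfAdjoint

lemma inner_sqrt_apply (A : H →L[ℂ] H) (x y : H) :
    ⟪CFC.sqrt A x, y⟫_ℂ = ⟪x, CFC.sqrt A y⟫_ℂ := by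
  rw [← adjoint_inner_right, adjoint_sqrt]

lemma inner_apply_eq_sq_norm_sqrt {A : H →L[ℂ] H} (hA : A.IsPositive) (x : H) :
    ⟪x, A x⟫_ℂ = ((‖CFC.sqrt A x‖₊ ^ 2 : NNReal) : ℂ) := by
  rw [← sqrt_apply_sqrt_apply hA, ← inner_sqrt_apply, inner_self_eq_norm_sq_to_K]
  simp

lemma tsum_sq_enorm_sqrt (b : HilbertBasis ι ℂ H) (c : HilbertBasis κ ℂ H) (A : H →L[ℂ] H) :
    ∑' n, ((‖CFC.sqrt A (b n)‖₊ ^ 2 : NNReal) : ℝ≥0∞) =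
      ∑' k, ((‖CFC.sqrt A (c k)‖₊ ^ 2 : NNReal) : ℝ≥0∞) := by
  simpa [enorm, adjoint_sqrt] using tsum_sq_enorm_apply b c (CFC.sqrt A)

lemma summable_ofNNReal_iff (f : ι → NNReal) :
    Summable (fun n => ((f n : NNReal) : ℂ)) ↔ Summable f := by
  rw [← NNReal.summable_coe]
  exact Complex.summable_ofReal (f := fun n => (f n : ℝ))

lemma tsum_inner_apply_basis {A : H →L[ℂ] H} (hA : A.IsPositive)
    (b : HilbertBasis ι ℂ H) (c : HilbertBasis κ ℂ H) :
    ∑' n, ⟪b n, A (b n)⟫_ℂ = ∑' k, ⟪c k, A (c k)⟫_ℂ := by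
  simp_rw [inner_apply_eq_sq_norm_sqrt hA]
  have := congrArg ENNReal.toNNReal (tsum_sq_enorm_sqrt b c A)
  rw [← NNReal.tsum_eq_toNNReal_tsum, ← NNReal.tsum_eq_toNNReal_tsum] at this
  have := congrArg (fun r : NNReal => ((r : ℝ) : ℂ)) this
  simpa only [NNReal.coe_tsum, Complex.ofReal_tsum] using this

lemma summable_inner_apply_basis {A : H →L[ℂ] H} (hA : A.IsPositive)
    (b : HilbertBasis ι ℂ H) (c : HilbertBasis κ ℂ H)
    (h : Summable fun n => ⟪b n, A (b n)⟫_ℂ) : Summable fun k => ⟪c k, A (c k)⟫_ℂ := by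
  simp_rw [inner_apply_eq_sq_norm_sqrt hA] at h ⊢
  rw [summable_ofNNReal_iff, ← ENNReal.tsum_coe_ne_top_iff_summable] at h ⊢
  rwa [← tsum_sq_enorm_sqrt b c A]

/-- The trace of a positive operator may be computed in any orthonormal basis. -/
lemma opTrace_eq_tsum {A : H →L[ℂ] H} (hA : A.IsPositive) (b : HilbertBasis ι ℂ H) :
    opTrace A = ∑' n, ⟪b n, A (b n)⟫_ℂ :=
  tsum_inner_apply_basis hA _ b

lemma IsState.hasSum_basis {ρ : H →L[ℂ] H} (hρ : IsState ρ) (b : HilbertBasis ι ℂ H) :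
    HasSum (fun n => ⟪b n, ρ (b n)⟫_ℂ) 1 := by
  rw [← hρ.trace_one.tsum_eq, tsum_inner_apply_basis hρ.positive (onb H) b]
  exact (summable_inner_apply_basis hρ.positive (onb H) b hρ.trace_one.summable).hasSum

lemma IsState.summable_sq_norm_sqrt {ρ : H →L[ℂ] H} (hρ : IsState ρ) (b : HilbertBasis ι ℂ H) :
    Summable fun n => ‖CFC.sqrt ρ (b n)‖ ^ 2 := by
  have h := (hρ.hasSum_basis b).summable
  simp_rw [inner_apply_eq_sq_norm_sqrt hρ.positive] at h
  rw [summable_ofNNReal_iff, ← NNReal.summable_coe] at h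
  simpa using h

/-- The Hilbert–Schmidt inner products of two operators and of their adjoints agree. -/
lemma tsum_inner_apply_apply (e : HilbertBasis ι ℂ H) (b : HilbertBasis κ ℂ H) (X Y : H →L[ℂ] H)
    (hX : Summable fun n => ‖X (e n)‖ ^ 2) (hY : Summable fun n => ‖Y (e n)‖ ^ 2) :
    ∑' n, ⟪X (e n), Y (e n)⟫_ℂ = ∑' k, ⟪adjoint Y (b k), adjoint X (b k)⟫_ℂ := by
  have key : ∀ Z : H →L[ℂ] H, Summable (fun n => ‖Z (e n)‖ ^ 2) →
      Summable fun p : ι × κ => ‖⟪b p.2, Z (e p.1)⟫_ℂ‖ ^ 2 := by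
    intro Z hZ
    refine (summable_prod_of_nonneg fun p => ?_).2 ⟨fun n => ?_, ?_⟩
    · exact sq_nonneg ‖⟪b p.2, Z (e p.1)⟫_ℂ‖
    · exact (hasSum_sq_norm_inner b (Z (e n))).summable
    · exact hZ.congr fun n => (hasSum_sq_norm_inner b (Z (e n))).tsum_eq.symm
  have hsum : Summable (Function.uncurry fun n k =>
      ⟪X (e n), b k⟫_ℂ * ⟪b k, Y (e n)⟫_ℂ) := by
    refine Summable.of_norm_bounded ((key X hX).add (key Y hY)) fun p => ?_
    rw [Function.uncurry, norm_mul, norm_inner_symm]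
    nlinarith [sq_nonneg (‖⟪b p.2, X (e p.1)⟫_ℂ‖ - ‖⟪b p.2, Y (e p.1)⟫_ℂ‖),
      sq_nonneg ‖⟪b p.2, X (e p.1)⟫_ℂ‖, sq_nonneg ‖⟪b p.2, Y (e p.1)⟫_ℂ‖]
  simp_rw [← b.tsum_inner_mul_inner (X _) (Y _),
    ← e.tsum_inner_mul_inner (adjoint Y _) (adjoint X _), adjoint_inner_left, adjoint_inner_right]
  rw [← hsum.tsum_comm]
  exact tsum_congr fun k => tsum_congr fun n => mul_comm _ _

/-- For a state `ρ`, `Tr (ρ A) = ∑ₖ ⟨√ρ bₖ, A √ρ bₖ⟩` for every orthonormal basis `b`. This combines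
cyclicity of the trace with its independence of the basis. -/
lemma IsState.opTrace_mul {ρ : H →L[ℂ] H} (hρ : IsState ρ) (A : H →L[ℂ] H)
    (b : HilbertBasis κ ℂ H) :
    opTrace (ρ * A) = ∑' k, ⟪CFC.sqrt ρ (b k), A (CFC.sqrt ρ (b k))⟫_ℂ := by
  set S := CFC.sqrt ρ with hS
  have hY : Summable fun n => ‖(S * A) (onb H n)‖ ^ 2 := by
    have h1 : Summable fun k => ‖adjoint (S * A) (b k)‖ ^ 2 := by
      refine Summable.of_nonneg_of_le (fun k => by positivity) (fun k => ?_)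
        ((hρ.summable_sq_norm_sqrt b).mul_left (‖adjoint A‖ ^ 2))
      rw [← mul_pow]
      gcongr
      have : adjoint (S * A) (b k) = adjoint A (S (b k)) := by
        rw [mul_def, adjoint_comp, hS, adjoint_sqrt]; rfl
      rw [this]
      exact le_opNorm _ _
    have h2 := tsum_sq_enorm_apply (onb H) b (S * A)
    have e1 : ∀ x : H, ‖x‖ₑ ^ 2 = ((‖x‖₊ ^ 2 : NNReal) : ℝ≥0∞) := fun x => by
      rw [ENNReal.coe_pow]; rfl
    have e2 : ∀ x : H, ‖x‖ ^ 2 = ((‖x‖₊ ^ 2 : NNReal) : ℝ) := fun x => by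
      rw [NNReal.coe_pow, coe_nnnorm]
    simp_rw [e1] at h2
    simp_rw [e2, NNReal.summable_coe, ← ENNReal.tsum_coe_ne_top_iff_summable] at h1 ⊢
    rwa [h2]
  have h := tsum_inner_apply_apply (onb H) b S (S * A) (hρ.summable_sq_norm_sqrt _) hY
  calc opTrace (ρ * A) = ∑' n, ⟪S (onb H n), (S * A) (onb H n)⟫_ℂ := by
        refine tsum_congr fun n => ?_
        rw [hS, inner_sqrt_apply]
        exact congrArg _ (sqrt_apply_sqrt_apply hρ.positive _).symm
    _ = _ := h
    _ = _ := by
        refine tsum_congr fun k => ?_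
        rw [mul_def, adjoint_comp, hS, adjoint_sqrt, ContinuousLinearMap.comp_apply,
          adjoint_inner_left]

/-- A state is a mixture `ρ = ∑ₙ |ψₙ⟩⟨ψₙ|` of countably many unnormalised vectors with
`∑ₙ ‖ψₙ‖² < ∞`; the second clause says this in matrix elements. -/
lemma IsState.exists_mixture {ρ : H →L[ℂ] H} (hρ : IsState ρ) :
    ∃ (s : Set H) (ψ : s → H), Countable s ∧ Summable (fun n => ‖ψ n‖ ^ 2) ∧
      (∀ x y, HasSum (fun n => ⟪x, ψ n⟫_ℂ * ⟪ψ n, y⟫_ℂ) ⟪x, ρ y⟫_ℂ) ∧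
      ∀ A, opTrace (ρ * A) = ∑' n, ⟪ψ n, A (ψ n)⟫_ℂ := by
  set g : onbIndex H → H := fun n => CFC.sqrt ρ (onb H n) with hg
  have hsum : Summable fun n => ‖g n‖ ^ 2 := hρ.summable_sq_norm_sqrt _
  -- Only countably many `√ρ eₙ` are nonzero; this avoids proving `H` separable.
  let s : Set H := Subtype.val '' {n | g n ≠ 0}
  have hsub : s ⊆ onbIndex H := by rintro _ ⟨n, -, rfl⟩; exact n.2
  have hinj : Function.Injective (Set.inclusion hsub) := Set.inclusion_injective hsub
  have hout : ∀ n, n ∉ Set.range (Set.inclusion hsub) → g n = 0 := by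
    intro n hn
    by_contra h
    exact hn ⟨⟨n, n, h, rfl⟩, rfl⟩
  refine ⟨s, fun n => g (Set.inclusion hsub n), ?_, hsum.comp_injective hinj, fun x y => ?_,
    fun A => ?_⟩
  · refine Set.Countable.image ?_ _
    convert hsum.countable_support using 1
    ext n
    simp
  · refine (hinj.hasSum_iff (f := fun n => ⟪x, g n⟫_ℂ * ⟪g n, y⟫_ℂ) fun n hn => ?_).2 ?_
    · rw [hout n hn, inner_zero_right, zero_mul]
    · have h := (onb H).hasSum_inner_mul_inner (CFC.sqrt ρ x) (CFC.sqrt ρ y)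
      simp_rw [inner_sqrt_apply ρ x] at h
      rw [sqrt_apply_sqrt_apply hρ.positive] at h
      simpa only [hg, inner_sqrt_apply] using h
  · rw [hρ.opTrace_mul A (onb H)]
    refine (hinj.tsum_eq (f := fun n => ⟪g n, A (g n)⟫_ℂ) fun n hn => ?_).symm
    by_contra h
    exact hn (by simp only [hout n h, inner_zero_left])

end Trace

/-! ### Unitary conjugation -/

section Conjugation

open ContinuousLinearMap

variable {H : Type*} [NormedAddCommGroup H] [InnerProductSpace ℂ H] [CompleteSpace H]

variable (e : H ≃ₗᵢ[ℂ] H)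

lemma isPositive_conj {A : H →L[ℂ] H} (hA : A.IsPositive) : (e.conjStarAlgEquiv A).IsPositive := by
  rw [← nonneg_iff_isPositive] at hA ⊢
  exact map_nonneg _ hA

lemma sqrt_conj {A : H →L[ℂ] H} (hA : A.IsPositive) :
    CFC.sqrt (e.conjStarAlgEquiv A) = e.conjStarAlgEquiv (CFC.sqrt A) := by
  refine CFC.sqrt_unique ?_ ?_
  · rw [← map_mul, sqrt_mul_sqrt hA]
  · exact map_nonneg _ (CFC.sqrt_nonneg A)

lemma inner_conj (A : H →L[ℂ] H) (x : H) :
    ⟪e x, e.conjStarAlgEquiv A (e x)⟫_ℂ = ⟪x, A x⟫_ℂ := by simp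

lemma opTrace_conj {A : H →L[ℂ] H} (hA : A.IsPositive) :
    opTrace (e.conjStarAlgEquiv A) = opTrace A := by
  rw [opTrace_eq_tsum (isPositive_conj e hA) (mapBasis (onb H) e)]
  simp only [mapBasis_apply, inner_conj]
  rfl

lemma IsState.conj {ρ : H →L[ℂ] H} (hρ : IsState ρ) : IsState (e.conjStarAlgEquiv ρ) where
  positive := isPositive_conj e hρ.positive
  trace_one := by
    have h := hρ.hasSum_basis (mapBasis (onb H) e.symm)
    convert h using 2 with n
    rw [mapBasis_apply, ← inner_conj e ρ, e.apply_symm_apply]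

lemma IsState.opTrace_conj_mul {ρ : H →L[ℂ] H} (hρ : IsState ρ) (A : H →L[ℂ] H) :
    opTrace (e.conjStarAlgEquiv ρ * A) = opTrace (ρ * e.symm.conjStarAlgEquiv A) := by
  rw [(hρ.conj e).opTrace_mul A (mapBasis (onb H) e), hρ.opTrace_mul _ (onb H)]
  refine tsum_congr fun n => ?_
  rw [mapBasis_apply, sqrt_conj e hρ.positive]
  rw [← e.symm.inner_map_map]
  simp

/-- The fidelity of positive operators is invariant under unitary conjugation. -/
lemma fidelity_conj {ρ σ : H →L[ℂ] H} (hρ : ρ.IsPositive) (hσ : σ.IsPositive) :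
    fidelity (e.conjStarAlgEquiv ρ) (e.conjStarAlgEquiv σ) = fidelity ρ σ := by
  have hpos : (CFC.sqrt ρ * σ * CFC.sqrt ρ).IsPositive := by
    have := hσ.conj_adjoint (CFC.sqrt ρ)
    rwa [adjoint_sqrt] at this
  unfold fidelity
  rw [sqrt_conj e hρ, ← map_mul, ← map_mul, sqrt_conj e hpos, opTrace_conj]
  exact (nonneg_iff_isPositive _).1 (CFC.sqrt_nonneg _)

end Conjugation

open scoped ComplexConjugate

/-! ### Injectivity of the Fourier transform on integrable functions -/

section Fourier

variable {m : ℕ}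

lemma phase_neg (a x : Fin m → ℝ) : phase (-a) x = conj (phase a x) := by
  simp [phase, ← Complex.exp_conj]

lemma integrable_phase_mul {f : (Fin m → ℝ) → ℂ} (hf : Integrable f) (a : Fin m → ℝ) :
    Integrable fun x => phase a x * f x := by
  refine hf.bdd_mul (continuous_phase a).aestronglyMeasurable (c := 1) ?_
  exact Filter.Eventually.of_forall fun x => (norm_phase a x).le

lemma integral_withDensity_ofReal_phase {f : (Fin m → ℝ) → ℝ} (hf : Integrable f)
    (a : Fin m → ℝ) :
    ∫ x, phase a x ∂volume.withDensity (fun x => ENNReal.ofReal (f x)) =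
      ∫ x, phase a x * ((max (f x) 0 : ℝ) : ℂ) := by
  rw [integral_withDensity_eq_integral_toReal_smul₀ hf.aemeasurable.ennreal_ofReal
    (Filter.Eventually.of_forall fun x => ENNReal.ofReal_lt_top)]
  refine integral_congr_ae (Filter.Eventually.of_forall fun x => ?_)
  simp only [ENNReal.toReal_ofReal', Complex.real_smul]
  ring

/-- A real integrable function with vanishing Fourier transform is zero: its positive and negative
parts are densities of finite measures with the same characteristic function. -/
lemma ae_eq_zero_of_integral_phase_ofReal {f : (Fin m → ℝ) → ℝ} (hf : Integrable f)
    (h : ∀ a, ∫ x, phase a x * (f x : ℂ) = 0) : f =ᵐ[volume] 0 := by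
  have := isFiniteMeasure_withDensity_ofReal hf.2
  have := isFiniteMeasure_withDensity_ofReal hf.neg.2
  have hmeas : (volume.withDensity fun x => ENNReal.ofReal (f x)) =
      volume.withDensity fun x => ENNReal.ofReal ((-f) x) := by
    refine Measure.ext_of_charFunDual (funext fun L => ?_)
    have hL : ∀ x, Complex.exp ((L x : ℂ) * Complex.I) =
        phase (fun k => L fun j => if k = j then 1 else 0) x := by
      intro x
      rw [phase, dotProduct]
      congr 3
      rw [← ContinuousLinearMap.coe_coe, LinearMap.pi_apply_eq_sum_univ L.toLinearMap x]
      simp [mul_comm]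
    simp_rw [charFunDual_apply, hL]
    rw [integral_withDensity_ofReal_phase hf, integral_withDensity_ofReal_phase hf.neg,
      ← sub_eq_zero, ← integral_sub]
    · rw [← h]
      refine integral_congr_ae (Filter.Eventually.of_forall fun x => ?_)
      simp only [Pi.neg_apply]
      rw [← mul_sub, ← Complex.ofReal_sub, max_zero_sub_eq_self]
    · exact integrable_phase_mul hf.pos_part.ofReal _
    · exact integrable_phase_mul hf.neg.pos_part.ofReal _
  have hfin : ∫⁻ x, ENNReal.ofReal (f x) ≠ ⊤ :=
    ((lintegral_mono fun x => Real.ofReal_le_enorm (f x)).trans_lt hf.2).ne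
  have hae := (withDensity_eq_iff hf.aemeasurable.ennreal_ofReal
    hf.neg.aemeasurable.ennreal_ofReal hfin).1 hmeas
  filter_upwards [hae] with x hx
  rcases le_total 0 (f x) with h0 | h0
  · rw [Pi.neg_apply, ENNReal.ofReal_of_nonpos (p := -f x) (by linarith),
      ENNReal.ofReal_eq_zero] at hx
    exact le_antisymm hx h0
  · rw [Pi.neg_apply, ENNReal.ofReal_of_nonpos h0, eq_comm, ENNReal.ofReal_eq_zero] at hx
    exact le_antisymm h0 (neg_nonpos.1 hx)

/-- Injectivity of the Fourier transform on `L¹(ℝᵐ; ℂ)`. -/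
lemma ae_eq_zero_of_integral_phase {f : (Fin m → ℝ) → ℂ} (hf : Integrable f)
    (h : ∀ a, ∫ x, phase a x * f x = 0) : f =ᵐ[volume] 0 := by
  have hconj : ∀ a, ∫ x, phase a x * conj (f x) = 0 := by
    intro a
    rw [← map_zero (starRingEnd ℂ), ← h (-a), ← integral_conj]
    simp [phase_neg]
  have hint : Integrable fun x => conj (f x) :=
    (Complex.conjCLE : ℂ →L[ℝ] ℂ).integrable_comp hf
  have hre : (fun x => (f x).re) =ᵐ[volume] 0 := by
    refine ae_eq_zero_of_integral_phase_ofReal hf.re fun a => ?_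
    have e : ∀ x, phase a x * ((f x).re : ℂ) =
        2⁻¹ * (phase a x * f x + phase a x * conj (f x)) := by
      intro x
      rw [← mul_add, Complex.add_conj]
      push_cast
      ring
    simp_rw [e]
    rw [integral_const_mul, integral_add (integrable_phase_mul hf a)
      (integrable_phase_mul hint a), h, hconj]
    simp
  have him : (fun x => (f x).im) =ᵐ[volume] 0 := by
    refine ae_eq_zero_of_integral_phase_ofReal hf.im fun a => ?_
    have e : ∀ x, phase a x * ((f x).im : ℂ) =
        (2 * Complex.I)⁻¹ * (phase a x * f x - phase a x * conj (f x)) := by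
      intro x
      rw [← mul_sub, Complex.sub_conj]
      push_cast
      field_simp
    simp_rw [e]
    rw [integral_const_mul, integral_sub (integrable_phase_mul hf a)
      (integrable_phase_mul hint a), h, hconj]
    simp
  filter_upwards [hre, him] with x h1 h2
  exact Complex.ext h1 h2

end Fourier

/-! ### The characteristic function determines the state -/

section Kernel

variable {m : ℕ}

lemma integral_norm_mul_norm_le (f g : ModeSpace m) :
    ∫ x, ‖f x‖ * ‖g x‖ ≤ ‖f‖ * ‖g‖ := by
  have hf := (Lp.memLp f).norm
  have hg := (Lp.memLp g).norm
  have h := real_inner_le_norm (hg.toLp _) (hf.toLp _)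
  rw [L2.inner_def, Lp.norm_toLp, Lp.norm_toLp, eLpNorm_norm, eLpNorm_norm, ← Lp.norm_def,
    ← Lp.norm_def, mul_comm ‖g‖] at h
  refine le_of_eq_of_le (integral_congr_ae ?_) h
  filter_upwards [hf.coeFn_toLp, hg.coeFn_toLp] with x h1 h2
  simp [h1, h2]

lemma translation_coeFn (b : Fin m → ℝ) (f : ModeSpace m) :
    translation b f =ᵐ[volume] fun x => f (x + b) :=
  Lp.coeFn_compMeasurePreserving f (measurePreserving_add_right volume b)

lemma norm_translation (b : Fin m → ℝ) (f : ModeSpace m) : ‖translation b f‖ = ‖f‖ :=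
  (Lp.compMeasurePreservingₗᵢ ℂ (fun x : Fin m → ℝ => x + b)
    (measurePreserving_add_right volume b)).norm_map f

/-- The integral kernel of `|f⟩⟨f|` (complex conjugated) in the coordinates `(x, x + b)`. -/
def rankOneKernel (f : ModeSpace m) (b x : Fin m → ℝ) : ℂ := conj (f x) * f (x + b)

lemma rankOneKernel_ae (f : ModeSpace m) (b : Fin m → ℝ) :
    rankOneKernel f b =ᵐ[volume] fun x => ⟪f x, translation b f x⟫_ℂ := by
  filter_upwards [translation_coeFn b f] with x hx
  rw [hx, rankOneKernel, RCLike.inner_apply, mul_comm]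

lemma integrable_rankOneKernel (f : ModeSpace m) (b : Fin m → ℝ) :
    Integrable (rankOneKernel f b) :=
  (L2.integrable_inner f (translation b f)).congr (rankOneKernel_ae f b).symm

lemma integral_norm_rankOneKernel_le (f : ModeSpace m) (b : Fin m → ℝ) :
    ∫ x, ‖rankOneKernel f b x‖ ≤ ‖f‖ ^ 2 := by
  have h := integral_norm_mul_norm_le f (translation b f)
  rw [norm_translation, ← sq] at h
  refine le_of_eq_of_le (integral_congr_ae ?_) h
  filter_upwards [translation_coeFn b f] with x hx
  simp [hx, rankOneKernel]

lemma inner_weyl (f : ModeSpace m) (ξ : Quad m → ℝ) :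
    ⟪f, weyl ξ f⟫_ℂ =
      Complex.exp ((((∑ k, ξ (k, 0) * ξ (k, 1)) / 2 : ℝ) : ℂ) * Complex.I) *
        ∫ x, phase (fun k => ξ (k, 0)) x * rankOneKernel f (fun k => ξ (k, 1)) x := by
  rw [weyl, _root_.smul_apply, inner_smul_right, L2.inner_def]
  congr 1
  refine integral_congr_ae ?_
  filter_upwards [translation_coeFn (fun k => ξ (k, 1)) f,
    modulationLin_coeFn (fun k => ξ (k, 0)) (translation (fun k => ξ (k, 1)) f)] with x h1 h2
  change ⟪f x, modulationLin _ (translation _ f) x⟫_ℂ = _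
  rw [h2, h1, rankOneKernel, RCLike.inner_apply]
  ring

variable {ι : Type*} [Countable ι]

/-- The (complex conjugated) integral kernel of `∑ₙ |ψₙ⟩⟨ψₙ|` in the coordinates `(x, x + b)`. -/
def mixtureKernel (ψ : ι → ModeSpace m) (b x : Fin m → ℝ) : ℂ := ∑' n, rankOneKernel (ψ n) b x

lemma measurable_mixtureKernel (ψ : ι → ModeSpace m) :
    Measurable fun z : (Fin m → ℝ) × (Fin m → ℝ) => mixtureKernel ψ z.1 z.2 := by
  have h : ∀ n, Measurable fun z : (Fin m → ℝ) × (Fin m → ℝ) => rankOneKernel (ψ n) z.1 z.2 := by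
    intro n
    have hm : Measurable (ψ n) := (Lp.stronglyMeasurable (ψ n)).measurable
    unfold rankOneKernel
    exact (continuous_star.measurable.comp (hm.comp measurable_snd)).mul
      (hm.comp (measurable_snd.add measurable_fst))
  exact Measurable.tsum (L := .unconditional ι) h

lemma integrable_mixtureKernel {ψ : ι → ModeSpace m} (hψ : Summable fun n => ‖ψ n‖ ^ 2)
    (b : Fin m → ℝ) : Integrable (mixtureKernel ψ b) := by
  refine ⟨((measurable_mixtureKernel ψ).comp measurable_prodMk_left).aestronglyMeasurable, ?_⟩
  have hsum : Summable fun n => ∫ x, ‖rankOneKernel (ψ n) b x‖ :=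
    .of_nonneg_of_le (fun n => integral_nonneg fun x => norm_nonneg _)
      (fun n => integral_norm_rankOneKernel_le (ψ n) b) hψ
  calc ∫⁻ x, ‖mixtureKernel ψ b x‖ₑ ≤ ∫⁻ x, ∑' n, ‖rankOneKernel (ψ n) b x‖ₑ :=
        lintegral_mono fun x => enorm_tsum_le_tsum_enorm
    _ = ∑' n, ∫⁻ x, ‖rankOneKernel (ψ n) b x‖ₑ :=
        lintegral_tsum fun n => (integrable_rankOneKernel (ψ n) b).1.enorm
    _ = ∑' n, ENNReal.ofReal (∫ x, ‖rankOneKernel (ψ n) b x‖) :=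
        tsum_congr fun n => (ofReal_integral_norm_eq_lintegral_enorm
          (integrable_rankOneKernel (ψ n) b)).symm
    _ < ⊤ := hsum.tsum_ofReal_lt_top

lemma tsum_inner_weyl {ψ : ι → ModeSpace m} (hψ : Summable fun n => ‖ψ n‖ ^ 2)
    (ξ : Quad m → ℝ) :
    ∑' n, ⟪ψ n, weyl ξ (ψ n)⟫_ℂ =
      Complex.exp ((((∑ k, ξ (k, 0) * ξ (k, 1)) / 2 : ℝ) : ℂ) * Complex.I) *
        ∫ x, phase (fun k => ξ (k, 0)) x * mixtureKernel ψ (fun k => ξ (k, 1)) x := by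
  simp_rw [inner_weyl, mixtureKernel, ← tsum_mul_left]
  rw [tsum_mul_left]
  congr 1
  refine integral_tsum_of_summable_integral_norm
    (fun n => integrable_phase_mul (integrable_rankOneKernel _ _) _) ?_
  simp_rw [norm_mul, norm_phase, one_mul]
  exact .of_nonneg_of_le (fun n => integral_nonneg fun x => norm_nonneg _)
      (fun n => integral_norm_rankOneKernel_le (ψ n) _) hψ

/-- Matrix elements of `∑ₙ |ψₙ⟩⟨ψₙ|` as integrals against its kernel. -/
lemma hasSum_inner_mul_inner_mixture {ψ : ι → ModeSpace m} (hψ : Summable fun n => ‖ψ n‖ ^ 2)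
    (f g : ModeSpace m) :
    HasSum (fun n => ⟪f, ψ n⟫_ℂ * ⟪ψ n, g⟫_ℂ)
      (∫ z : (Fin m → ℝ) × (Fin m → ℝ),
        conj (f (z.2 + z.1)) * g z.2 * mixtureKernel ψ z.1 z.2) := by
  let E := Fin m → ℝ
  let P : ι → E × E → ℂ := fun n z => ⟪ψ n z.1, g z.1⟫_ℂ * ⟪f z.2, ψ n z.2⟫_ℂ
  have hP : ∀ n, Integrable (P n) := fun n =>
    (L2.integrable_inner (𝕜 := ℂ) (ψ n) g).mul_prod (L2.integrable_inner (𝕜 := ℂ) f (ψ n))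
  have hPint : ∀ n, ∫ z, P n z = ⟪f, ψ n⟫_ℂ * ⟪ψ n, g⟫_ℂ := fun n => by
    rw [L2.inner_def, L2.inner_def, mul_comm]
    exact integral_prod_mul (fun x => ⟪ψ n x, g x⟫_ℂ) (fun x => ⟪f x, ψ n x⟫_ℂ)
  have hPnorm : ∀ n, ∫ z, ‖P n z‖ ≤ ‖f‖ * ‖g‖ * ‖ψ n‖ ^ 2 := fun n => by
    have e : ∀ z, ‖P n z‖ = (‖ψ n z.1‖ * ‖g z.1‖) * (‖f z.2‖ * ‖ψ n z.2‖) := fun z => by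
      simp [P, mul_comm]
    simp_rw [e]
    have h1 := integral_norm_mul_norm_le (ψ n) g
    have h2 := integral_norm_mul_norm_le f (ψ n)
    calc _ = (∫ x, ‖ψ n x‖ * ‖g x‖) * ∫ x, ‖f x‖ * ‖ψ n x‖ :=
          integral_prod_mul (fun x => ‖ψ n x‖ * ‖g x‖) (fun x => ‖f x‖ * ‖ψ n x‖)
      _ ≤ (‖ψ n‖ * ‖g‖) * (‖f‖ * ‖ψ n‖) := by
          gcongr
      _ = _ := by ring
  have hT : MeasurePreserving (fun z : E × E => (z.2, z.2 + z.1)) :=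
    measurePreserving_prod_add_swap volume volume
  have hTe : MeasurableEmbedding (fun z : E × E => (z.2, z.2 + z.1)) :=
    ((MeasurableEquiv.prodComm.trans (MeasurableEquiv.shearAddRight E))).measurableEmbedding
  have hsum := hasSum_integral_of_summable_integral_norm
    (F := fun n z => P n (z.2, z.2 + z.1)) (μ := (volume : Measure (E × E)))
    (fun n => (hT.integrable_comp_emb hTe).2 (hP n)) ?_
  · have e1 : (fun n => ⟪f, ψ n⟫_ℂ * ⟪ψ n, g⟫_ℂ) =
        fun n => ∫ z : E × E, P n (z.2, z.2 + z.1) := by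
      ext n
      rw [← hPint]
      exact (hT.integral_comp hTe (P n)).symm
    have e2 : ∀ z : E × E, conj (f (z.2 + z.1)) * g z.2 * mixtureKernel ψ z.1 z.2 =
        ∑' n, P n (z.2, z.2 + z.1) := by
      intro z
      rw [mixtureKernel, ← tsum_mul_left]
      refine tsum_congr fun n => ?_
      simp only [P, rankOneKernel, RCLike.inner_apply]
      ring
    simp_rw [e2]
    rwa [e1]
  · refine .of_nonneg_of_le (fun n => integral_nonneg fun x => norm_nonneg _) (fun n => ?_)
      (hψ.mul_left (‖f‖ * ‖g‖))
    exact (hT.integral_comp hTe fun z => ‖P n z‖).trans_le (hPnorm n)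

/-- The characteristic function determines the state. -/
theorem IsState.eq_of_charFn_eq {ρ σ : Op m} (hρ : IsState ρ) (hσ : IsState σ)
    (h : ∀ ξ, charFn ρ ξ = charFn σ ξ) : ρ = σ := by
  obtain ⟨s, ψ, hs, hψ, hρm, hρt⟩ := hρ.exists_mixture
  obtain ⟨t, φ, ht, hφ, hσm, hσt⟩ := hσ.exists_mixture
  -- For fixed displacement `b`, the characteristic functions are the Fourier transforms of the
  -- kernels in the variable `x`.
  have hker : ∀ b, mixtureKernel ψ b =ᵐ[volume] mixtureKernel φ b := by
    intro b
    have hi := integrable_mixtureKernel hψ b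
    have hj := integrable_mixtureKernel hφ b
    rw [← sub_ae_eq_zero]
    refine ae_eq_zero_of_integral_phase (hi.sub hj) fun a => ?_
    have hab := h fun r => if r.2 = 0 then a r.1 else b r.1
    rw [charFn, charFn, hρt, hσt, tsum_inner_weyl hψ, tsum_inner_weyl hφ] at hab
    simp only [one_ne_zero, if_true, if_false] at hab
    have hab := mul_left_cancel₀ (Complex.exp_ne_zero _) hab
    simp_rw [Pi.sub_apply, mul_sub]
    rw [integral_sub (integrable_phase_mul hi a) (integrable_phase_mul hj a), sub_eq_zero]
    exact hab
  have hker' : ∀ᵐ z : (Fin m → ℝ) × (Fin m → ℝ),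
      mixtureKernel ψ z.1 z.2 = mixtureKernel φ z.1 z.2 := by
    refine (Measure.ae_prod_iff_ae_ae (measurableSet_eq_fun (measurable_mixtureKernel ψ)
      (measurable_mixtureKernel φ))).2 (Filter.Eventually.of_forall hker)
  ext1 g
  refine ext_inner_left ℂ fun f => ?_
  rw [(hρm f g).unique (hasSum_inner_mul_inner_mixture hψ f g),
    (hσm f g).unique (hasSum_inner_mul_inner_mixture hφ f g)]
  refine integral_congr_ae ?_
  filter_upwards [hker'] with z hz
  rw [hz]

end Kernel

/-! ### Permutations of the modes -/

section Relabelling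

variable {m : ℕ}

lemma measurePreserving_comp_perm (e : Equiv.Perm (Fin m)) :
    MeasurePreserving (fun x : Fin m → ℝ => x ∘ e) :=
  volume_preserving_arrowCongr' e.symm (MeasurableEquiv.refl ℝ) (.id volume)

/-- Composition with the coordinate permutation `x ↦ x ∘ e` as an isometry. -/
def relabelIsometry (e : Equiv.Perm (Fin m)) : ModeSpace m →ₗᵢ[ℂ] ModeSpace m :=
  Lp.compMeasurePreservingₗᵢ ℂ (fun x : Fin m → ℝ => x ∘ e) (measurePreserving_comp_perm e)

lemma relabelIsometry_coeFn (e : Equiv.Perm (Fin m)) (f : ModeSpace m) :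
    relabelIsometry e f =ᵐ[volume] fun x => f (x ∘ e) :=
  Lp.coeFn_compMeasurePreserving f (measurePreserving_comp_perm e)

lemma ae_comp_perm (e : Equiv.Perm (Fin m)) {p : (Fin m → ℝ) → Prop} (h : ∀ᵐ x, p x) :
    ∀ᵐ x : Fin m → ℝ, p (x ∘ e) :=
  (measurePreserving_comp_perm e).quasiMeasurePreserving.ae h

lemma relabelIsometry_symm_apply (e : Equiv.Perm (Fin m)) (f : ModeSpace m) :
    relabelIsometry e (relabelIsometry e.symm f) = f := by
  refine Lp.ext ?_
  filter_upwards [relabelIsometry_coeFn e (relabelIsometry e.symm f),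
    ae_comp_perm e (relabelIsometry_coeFn e.symm f)] with x h1 h2
  rw [h1, h2, Function.comp_assoc, e.self_comp_symm, Function.comp_id]

/-- The unitary `(U f)(x) = f (x ∘ e)` on `L²(ℝᵐ)` that permutes the modes. -/
def relabel (e : Equiv.Perm (Fin m)) : ModeSpace m ≃ₗᵢ[ℂ] ModeSpace m where
  toLinearEquiv := LinearEquiv.ofLinearMap (relabelIsometry e).toLinearMap
    (relabelIsometry e.symm).toLinearMap
    (LinearMap.ext fun f => relabelIsometry_symm_apply e f)
    (LinearMap.ext fun f => relabelIsometry_symm_apply e.symm f)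
  norm_map' f := (relabelIsometry e).norm_map f

lemma relabel_coeFn (e : Equiv.Perm (Fin m)) (f : ModeSpace m) :
    relabel e f =ᵐ[volume] fun x => f (x ∘ e) :=
  relabelIsometry_coeFn e f

lemma translation_relabel (e : Equiv.Perm (Fin m)) (b : Fin m → ℝ) (f : ModeSpace m) :
    translation b (relabel e f) = relabel e (translation (b ∘ e) f) := by
  refine Lp.ext ?_
  have hb := (measurePreserving_add_right (volume : Measure (Fin m → ℝ)) b).quasiMeasurePreserving
  filter_upwards [translation_coeFn b (relabel e f), hb.ae (relabel_coeFn e f),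
    relabel_coeFn e (translation (b ∘ e) f), ae_comp_perm e (translation_coeFn (b ∘ e) f)]
    with x h1 h2 h3 h4
  rw [h1, h2, h3, h4]
  rfl

lemma modulation_relabel (e : Equiv.Perm (Fin m)) (a : Fin m → ℝ) (f : ModeSpace m) :
    modulation a (relabel e f) = relabel e (modulation (a ∘ e) f) := by
  refine Lp.ext ?_
  filter_upwards [modulationLin_coeFn a (relabel e f), relabel_coeFn e f,
    relabel_coeFn e (modulation (a ∘ e) f), ae_comp_perm e (modulationLin_coeFn (a ∘ e) f)]
    with x h1 h2 h3 h4
  change modulationLin a (relabel e f) x = _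
  rw [h1, h2, h3]
  refine Eq.trans ?_ h4.symm
  rw [phase, phase, comp_equiv_dotProduct_comp_equiv]

/-- The permutation of the quadratures induced by a permutation of the modes. -/
def quadPerm (e : Equiv.Perm (Fin m)) : Equiv.Perm (Quad m) := e.prodCongr (.refl _)

lemma weyl_relabel (e : Equiv.Perm (Fin m)) (ξ : Quad m → ℝ) (f : ModeSpace m) :
    weyl ξ (relabel e f) = relabel e (weyl (ξ ∘ quadPerm e) f) := by
  have hsum : ∑ k, (ξ ∘ quadPerm e) (k, 0) * (ξ ∘ quadPerm e) (k, 1) =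
      ∑ k, ξ (k, 0) * ξ (k, 1) := Equiv.sum_comp e fun k => ξ (k, 0) * ξ (k, 1)
  rw [weyl, weyl, hsum, _root_.smul_apply, _root_.smul_apply, map_smul]
  congr 1
  change modulation _ (translation _ (relabel e f)) = _
  rw [translation_relabel, modulation_relabel]
  rfl

lemma conj_symm_weyl (e : Equiv.Perm (Fin m)) (ξ : Quad m → ℝ) :
    (relabel e).symm.conjStarAlgEquiv (weyl ξ) = weyl (ξ ∘ quadPerm e) := by
  ext1 f
  rw [LinearIsometryEquiv.conjStarAlgEquiv_apply_apply, LinearIsometryEquiv.symm_symm,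
    weyl_relabel, LinearIsometryEquiv.symm_apply_apply]

lemma IsState.charFn_relabel {ρ : Op m} (hρ : IsState ρ) (e : Equiv.Perm (Fin m))
    (ξ : Quad m → ℝ) :
    charFn ((relabel e).conjStarAlgEquiv ρ) ξ = charFn ρ (ξ ∘ quadPerm e) := by
  rw [charFn, hρ.opTrace_conj_mul, conj_symm_weyl, charFn]

lemma gaussianFactor_comp {V W : Matrix (Quad m) (Quad m) ℝ} (τ : Equiv.Perm (Quad m))
    (h : ∀ r s, V r s = W (τ r) (τ s)) (ξ : Quad m → ℝ) :
    gaussianFactor V (ξ ∘ τ) = gaussianFactor W ξ := by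
  obtain rfl : V = W.submatrix τ τ := by
    ext r s
    exact h r s
  rw [gaussianFactor, gaussianFactor, submatrix_mulVec_equiv, Function.comp_assoc,
    τ.self_comp_symm, Function.comp_id, comp_equiv_dotProduct_comp_equiv]

/-- A CV-GHZ state is invariant under permutations of the modes. -/
lemma IsGHZState.relabel_eq {μ c₁ c₂ : ℝ} {Φ : Op m} (hΦ : IsGHZState m μ c₁ c₂ Φ)
    (e : Equiv.Perm (Fin m)) : (relabel e).conjStarAlgEquiv Φ = Φ := by
  refine (hΦ.isState.conj _).eq_of_charFn_eq hΦ.isState fun ξ => ?_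
  rw [hΦ.isState.charFn_relabel, hΦ.charFn_eq, hΦ.charFn_eq]
  exact gaussianFactor_comp _ (fun r s => by simp [ghzCov, quadPerm]) ξ

lemma IsGaussianImage.unique {X Y : Matrix (Quad m) (Quad m) ℝ} {ρ σ σ' : Op m}
    (h : IsGaussianImage X Y ρ σ) (h' : IsGaussianImage X Y ρ σ') : σ = σ' :=
  h.isState.eq_of_charFn_eq h'.isState fun ξ => by rw [h.charFn_eq, h'.charFn_eq]

lemma IsGaussianImage.relabel {x y : Fin m → ℝ} {ρ σ : Op m} (e : Equiv.Perm (Fin m))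
    (hρ : IsState ρ) (h : IsGaussianImage (blockScalar (x ∘ e)) (blockScalar (y ∘ e)) ρ σ) :
    IsGaussianImage (blockScalar x) (blockScalar y) ((relabel e).conjStarAlgEquiv ρ)
      ((BosonicPattern.relabel e).conjStarAlgEquiv σ) where
  isState := h.isState.conj _
  charFn_eq ξ := by
    rw [h.isState.charFn_relabel, h.charFn_eq, hρ.charFn_relabel]
    congr 1
    · congr 1
      ext r
      simp [blockScalar, mulVec_diagonal, quadPerm]
    · refine gaussianFactor_comp _ (fun r s => ?_) ξ
      simp only [blockScalar, diagonal_apply, EmbeddingLike.apply_eq_iff_eq]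
      rfl

end Relabelling

/-! ### Channel patterns -/

section Patterns

variable {m : ℕ}

lemma patternOutput_of_image {B T : GPIChannel} {i : Pattern m} {ρ σ : Op m}
    (h : IsGaussianImage (blockScalar fun k => √(channelAt B T i k).τ)
      (blockScalar fun k => (channelAt B T i k).ν) ρ σ) : patternOutput B T i ρ = σ := by
  have hex : ∃ σ, IsGaussianImage (blockScalar fun k => √(channelAt B T i k).τ)
      (blockScalar fun k => (channelAt B T i k).ν) ρ σ := ⟨σ, h⟩
  rw [patternOutput, dif_pos hex]
  exact hex.choose_spec.unique h

lemma isPositive_patternOutput (B T : GPIChannel) (i : Pattern m) (ρ : Op m) :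
    (patternOutput B T i ρ).IsPositive := by
  rw [patternOutput]
  split_ifs with h
  · exact h.choose_spec.isState.positive
  · exact ContinuousLinearMap.isPositive_zero

/-- On a permutation-invariant input, permuting the channels permutes the modes of the output. -/
lemma patternOutput_relabel (B T : GPIChannel) (i : Pattern m) {ρ : Op m} (hρ : IsState ρ)
    (hinv : ∀ e : Equiv.Perm (Fin m), (relabel e).conjStarAlgEquiv ρ = ρ)
    (e : Equiv.Perm (Fin m)) :
    (relabel e).conjStarAlgEquiv (patternOutput B T (i ∘ e) ρ) = patternOutput B T i ρ := by
  -- The channels of `j` are those of `j ∘ e'` relabelled by `e'`.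
  have himage : ∀ (j : Pattern m) (e' : Equiv.Perm (Fin m)) (σ : Op m),
      IsGaussianImage (blockScalar fun k => √(channelAt B T (j ∘ e') k).τ)
        (blockScalar fun k => (channelAt B T (j ∘ e') k).ν) ρ σ →
      IsGaussianImage (blockScalar fun k => √(channelAt B T j k).τ)
        (blockScalar fun k => (channelAt B T j k).ν) ρ ((relabel e').conjStarAlgEquiv σ) := by
    intro j e' σ h
    have h' := IsGaussianImage.relabel (x := fun k => √(channelAt B T j k).τ)
      (y := fun k => (channelAt B T j k).ν) e' hρ h
    rwa [hinv] at h'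
  by_cases hex : ∃ σ, IsGaussianImage (blockScalar fun k => √(channelAt B T (i ∘ e) k).τ)
      (blockScalar fun k => (channelAt B T (i ∘ e) k).ν) ρ σ
  · obtain ⟨σ, hσ⟩ := hex
    rw [patternOutput_of_image hσ, patternOutput_of_image (himage i e σ hσ)]
  · have hex' : ¬ ∃ σ, IsGaussianImage (blockScalar fun k => √(channelAt B T i k).τ)
        (blockScalar fun k => (channelAt B T i k).ν) ρ σ := by
      rintro ⟨σ, hσ⟩
      have hi : (i ∘ e) ∘ e.symm = i := by
        rw [Function.comp_assoc, e.self_comp_symm, Function.comp_id]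
      exact hex ⟨_, himage (i ∘ e) e.symm σ (by rwa [hi])⟩
    rw [patternOutput, patternOutput, dif_neg hex, dif_neg hex', map_zero]

lemma card_fiber_relations (i i' : Pattern m) (n : Bool × Bool → ℕ)
    (hn : ∀ c, n c = Fintype.card {k // (i k, i' k) = c}) :
    n (true, true) + n (true, false) = numTargets i ∧
    n (true, true) + n (false, true) = numTargets i' ∧
    n (true, false) + n (false, true) = hammingDist i i' ∧
    n (true, true) + n (true, false) + n (false, true) + n (false, false) = m := by
  simp only [hn, Fintype.card_subtype, numTargets, hammingDist, Finset.card_filter,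
    ← Finset.sum_add_distrib]
  refine ⟨?_, ?_, ?_, ?_⟩
  iterate 3
    refine Finset.sum_congr rfl fun k _ => ?_
    cases i k <;> cases i' k <;> simp
  conv_rhs => rw [← Finset.card_fin m, Finset.card_eq_sum_ones]
  refine Finset.sum_congr rfl fun k _ => ?_
  cases i k <;> cases i' k <;> simp

/-- Two pairs of patterns with the same target numbers and the same Hamming distance differ by a
permutation of the modes: these numbers determine how many modes carry each of the four possible
pairs of labels. -/
lemma exists_perm_of_numTargets_eq {i i' j j' : Pattern m} (h : numTargets i = numTargets j)
    (h' : numTargets i' = numTargets j') (hd : hammingDist i i' = hammingDist j j') :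
    ∃ e : Equiv.Perm (Fin m), j ∘ e = i ∧ j' ∘ e = i' := by
  have hcard : ∀ c, Fintype.card {k // (i k, i' k) = c} = Fintype.card {k // (j k, j' k) = c} := by
    have h1 := card_fiber_relations i i' _ fun _ => rfl
    have h2 := card_fiber_relations j j' _ fun _ => rfl
    rintro ⟨_ | _, _ | _⟩ <;> omega
  let e := Equiv.ofFiberEquiv fun c => Fintype.equivOfCardEq (hcard c)
  have he : ∀ k, (j (e k), j' (e k)) = (i k, i' k) := fun k =>
    Equiv.ofFiberEquiv_map (fun c => Fintype.equivOfCardEq (hcard c)) k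
  exact ⟨e, funext fun k => congrArg Prod.fst (he k), funext fun k => congrArg Prod.snd (he k)⟩

end Patterns

end BosonicPattern

end

open BosonicPattern in
theorem lemma1 (m : ℕ) (B T : GPIChannel) (μ c₁ c₂ : ℝ) (Φ : Op m)
    (hΦ : IsGHZState m μ c₁ c₂ Φ) :
    ∃ Ftilde : ℕ → ℕ → ℕ → ℝ,
      ∀ (u v d : ℕ) (U V : Set (Pattern m)), 0 < d →
        (∀ i ∈ U, numTargets i = u) → (∀ i' ∈ V, numTargets i' = v) →
        (∀ i ∈ U, ∀ i' ∈ V, i ≠ i' → hammingDist i i' = d) →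
        ∀ i ∈ U, ∀ i' ∈ V, i ≠ i' →
          fidelity (patternOutput B T i Φ) (patternOutput B T i' Φ) = Ftilde u v d := by
  have hconst : ∀ i i' j j' : Pattern m, numTargets i = numTargets j →
      numTargets i' = numTargets j' → hammingDist i i' = hammingDist j j' →
      fidelity (patternOutput B T i Φ) (patternOutput B T i' Φ) =
        fidelity (patternOutput B T j Φ) (patternOutput B T j' Φ) := by
    intro i i' j j' h h' hd
    obtain ⟨e, rfl, rfl⟩ := exists_perm_of_numTargets_eq h h' hd
    rw [← patternOutput_relabel B T j hΦ.isState hΦ.relabel_eq e,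
      ← patternOutput_relabel B T j' hΦ.isState hΦ.relabel_eq e,
      fidelity_conj _ (isPositive_patternOutput _ _ _ _) (isPositive_patternOutput _ _ _ _)]
  classical
  -- `Ftilde u v d` is the fidelity of any pair of patterns with these numbers, if there is one.
  let S (u v d : ℕ) (p : Pattern m × Pattern m) : Prop :=
    numTargets p.1 = u ∧ numTargets p.2 = v ∧ hammingDist p.1 p.2 = d
  refine ⟨fun u v d => if h : ∃ p, S u v d p then
    fidelity (patternOutput B T h.choose.1 Φ) (patternOutput B T h.choose.2 Φ) else 0, ?_⟩
  intro u v d U V _ hU hV hd i hi i' hi' hne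
  have hex : ∃ p, S u v d p := ⟨(i, i'), hU i hi, hV i' hi', hd i hi i' hi' hne⟩
  obtain ⟨h1, h2, h3⟩ := hex.choose_spec
  simp only [dif_pos hex]
  exact hconst _ _ _ _ ((hU i hi).trans h1.symm) ((hV i' hi').trans h2.symm)
    ((hd i hi i' hi' hne).trans h3.symm)
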